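/- Let $M$ be a compact smooth manifold with (possibly empty) boundary, of dimension $n\ge 3$. Let $P$ assign to every smooth Riemannian metric $g$ on $M$ a linear operator $P_g$ with values in $C^\infty(M)$, defined on a linear subspace $D_g\subset C^\infty(M)$ (the functions satisfying the boundary condition). Let $\mathcal C$ be a set of metrics, for instance the set of all metrics, on which $P$ is conformally covariant: there are $a,b\in\mathbb R$ such that for all $g,\,e^{2\omega}g\in\mathcal C$ with $\omega\in C^\infty(M)$, one has $D_{e^{2\omega}g}=e^{-a\omega}D_g$ and $P_{e^{2\omega}g}=e^{-b\omega}P_g\,e^{a\omega}$. Suppose also that, for all such $g,\omega$, $$\ker P_{e^{2\omega}g}=e^{-(n/2-1)\omega}\ker P_g .$$ Let $g\in\mathcal C$ with $\dim\ker P_g\ge 1$, let $\hat g=e^{2\omega}g\in\mathcal C$, and for $u\in\ker P_g$ put $\hat u=e^{-(n/2-1)\omega}u$. For a function $u$ let $\mathcal N(u)$ be its zero set; its nodal domains are the connected components of the complement of $\mathcal N(u)$. Then: 1. $\dim\ker P_{\hat g}=\dim\ker P_g$. 2. If, for $h=g$ and for $h=\hat g$, the operator $P_h$ is symmetric in $L^2(M,d\mathrm{vol}_h)$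 and the linear span of its eigenfunctions is dense in $L^2(M,d\mathrm{vol}_h)$, then $P_{\hat g}$ and $P_g$ have the same number (in $\mathbb N\cup\{\infty\}$) of negative eigenvalues, counted with multiplicity. 3. For each nonzero $u\in\ker P_g$, the function $\hat u$ is a nonzero element of $\ker P_{\hat g}$ with the same nodal set and the same nodal domains as $u$. Hence the collection of the nodal sets, and that of the systems of nodal domains, of the nonzero elements of the kernel are the same for $g$ and $\hat g$. 4. If $\dim\ker P_g\ge 2$, the collection of the non-empty intersections of nodal sets, and of complements of nodal sets, of nonzero elements of the kernel is the same for $g$ and $\hat g$; so is the collection of the complements of the non-empty intersections of nodal sets. 5. Let $k\ge 2$, let $(u_1,\dots,u_k)$ be a basis of $\ker P_g$ and $(u_1',\dots,u_k')$ a basis of $\ker P_{\hat g}$. Then $\bigcap_i\mathcal N(u_i)=\bigcap_i\mathcal N(u_i')$. Let $\widetilde M$ be the complement of this set, and let $\Phi_g(x)=(u_1(x):\dots:u_k(x))$ and $\Phi_{\hat g}(x)=(u_1'(x):\dots:u_k'(x))$ be the resulting maps $\widetilde M\to\mathbb{RP}^{k-1}$. There is $A\in GL_k(\mathbb R)$ with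 $\Phi_{\hat g}=A\,\Phi_g$ on $\widetilde M$. In particular $\Phi_g(\widetilde M)$ and $\Phi_{\hat g}(\widetilde M)$ have the same orbit under $GL_k(\mathbb R)$, and so do $\Phi_g(\widetilde M\cap\partial M)$ and $\Phi_{\hat g}(\widetilde M\cap\partial M)$. 6. The same holds on $\partial M$ for restrictions. That is: the dimension of the space $\{u|_{\partial M}:u\in\ker P_g\}$, the nodal sets and nodal domains in $\partial M$ of its nonzero elements, and the collections of intersections and complements as in 4 are the same for $g$ and $\hat g$; for each $u\in\ker P_g$, $u|_{\partial M}$ and $\hat u|_{\partial M}$ have the same nodal set and nodal domains; and for bases (with $k$ elements) of the restricted spaces for $g$ and $\hat g$, the common nodal sets agree and the images of the projective maps have the same orbit under $GL_k(\mathbb R)$. 7. Let $p=2n/(n-2)$ and $u\in\ker P_g$. Then $|\hat u|^p\,d\mathrm{vol}_{\hat g}=|u|^p\,d\mathrm{vol}_g$ as measures on $M$. In particular $\|\hat u\|_{L^p(M,d\mathrm{vol}_{\hat g})}=\|u\|_{L^p(M,d\mathrm{vol}_g)}$, and $\int_\Omega|\hat u|^p\,d\mathrm{vol}_{\hat g}=\int_\Omega|u|^p\,d\mathrm{vol}_g$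 for every measurable set (in particular every domain) $\Omega\subset M$. For every smoothly immersed submanifold $N$ of $M$ of dimension $d$ (for instance $N=\partial M$, $d=n-1$), the same three statements hold for the restrictions of $u,\hat u$ to $N$, the volume measures of the metrics induced on $N$, and the exponent $p(N)=2d/(n-2)$. -/

import Mathlib

open scoped Manifold ContDiff LinearAlgebra.Projectivization Pointwise MatrixGroups
open MeasureTheory

noncomputable section

namespace ConfNodal

/-! ### Metrics, volume and smooth functions -/

/-- Smooth real functions (up to the boundary) on an `n`-manifold with boundary. -/
abbrev Smooth (n : ℕ) [NeZero n] (M : Type*) [TopologicalSpace M]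
    [ChartedSpace (EuclideanHalfSpace n) M] : Type _ :=
  ContMDiffMap (𝓡∂ n) 𝓘(ℝ, ℝ) M ℝ ∞

/-- Smooth Riemannian metrics on an `n`-manifold with boundary. -/
abbrev Metric (n : ℕ) [NeZero n] (M : Type*) [TopologicalSpace M]
    [ChartedSpace (EuclideanHalfSpace n) M] [IsManifold (𝓡∂ n) ∞ M] : Type _ :=
  Bundle.ContMDiffRiemannianMetric (𝓡∂ n) ∞ (EuclideanSpace ℝ (Fin n))
    (fun x : M => TangentSpace (𝓡∂ n) x)

section Volume

variable {d : ℕ} {H : Type*} [TopologicalSpace H]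
  (I : ModelWithCorners ℝ (EuclideanSpace ℝ (Fin d)) H)
  {N : Type*} [TopologicalSpace N] [ChartedSpace H N]

/-- The `i`-th coordinate vector `∂/∂xⁱ` of the chart at `c`, at the point with coordinates `y`. -/
def coordVec (c : N) (y : EuclideanSpace ℝ (Fin d)) (i : Fin d) :
    TangentSpace I ((extChartAt I c).symm y) :=
  mfderivWithin 𝓘(ℝ, EuclideanSpace ℝ (Fin d)) I (extChartAt I c).symm (Set.range I) y
    (EuclideanSpace.single i (1 : ℝ))

/-- `√det (h_ij)` in the chart at `c`, for a field `h` of forms on the tangent spaces. -/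
def sqrtDet (h : ∀ x : N, TangentSpace I x → TangentSpace I x → ℝ) (c : N)
    (y : EuclideanSpace ℝ (Fin d)) : ℝ :=
  Real.sqrt (Matrix.det (Matrix.of fun i j : Fin d =>
    h ((extChartAt I c).symm y) (coordVec I c y i) (coordVec I c y j)))

/-- The measure `√det (h_ij) dx¹ ⋯ dxᵈ` on the domain of the chart at `c`. -/
def chartVol [MeasurableSpace N] (h : ∀ x : N, TangentSpace I x → TangentSpace I x → ℝ) (c : N) :
    Measure N :=
  Measure.map (extChartAt I c).symm
    ((volume.restrict (extChartAt I c).target).withDensity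
      fun y => ENNReal.ofReal (sqrtDet I h c y))

variable (N) in
/-- A smooth partition of unity subordinate to the charts. -/
def chartPartition [IsManifold I ∞ N] [T2Space N] [SigmaCompactSpace N] :
    SmoothPartitionOfUnity N I N Set.univ :=
  (SmoothPartitionOfUnity.exists_isSubordinate_chartAt_source I N).choose

/-- The Riemannian volume measure of `h`: the chart measures, glued by a partition of unity. It
does not depend on the partition, by the change of variables formula. -/
def vol [IsManifold I ∞ N] [T2Space N] [SigmaCompactSpace N] [MeasurableSpace N]
    (h : ∀ x : N, TangentSpace I x → TangentSpace I x → ℝ) : Measure N :=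
  Measure.sum fun c : N =>
    (chartVol I h c).withDensity fun x => ENNReal.ofReal (chartPartition I N c x)

end Volume

section Manifold

variable {n : ℕ} [NeZero n] {M : Type*} [TopologicalSpace M]
  [ChartedSpace (EuclideanHalfSpace n) M]

/-- The smooth positive function `e^{cφ}`. -/
def expMul (c : ℝ) (φ : Smooth n M) : Smooth n M :=
  ⟨fun x => Real.exp (c * φ x),
    Real.contDiff_exp.comp_contMDiff (contMDiff_const.mul φ.contMDiff)⟩

variable [IsManifold (𝓡∂ n) ∞ M]

/-- `g' = e^{2φ} g`. -/
def IsConformalChange (g g' : Metric n M) (φ : Smooth n M) : Prop :=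
  ∀ (x : M) (v w : TangentSpace (𝓡∂ n) x),
    g'.inner x v w = Real.exp (2 * φ x) * g.inner x v w

/-- The Riemannian volume measure of the metric `g`. -/
def volM [T2Space M] [SigmaCompactSpace M] [MeasurableSpace M] (g : Metric n M) : Measure M :=
  vol (𝓡∂ n) fun x v w => g.inner x v w

/-- The Riemannian volume measure, on an immersed submanifold `ι : N → M`, of the induced
metric `ι^* g`. -/
def volSub (g : Metric n M) {d : ℕ} {H : Type*} [TopologicalSpace H]
    (J : ModelWithCorners ℝ (EuclideanSpace ℝ (Fin d)) H)
    {N : Type*} [TopologicalSpace N] [ChartedSpace H N] [IsManifold J ∞ N] [T2Space N]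
    [SigmaCompactSpace N] [MeasurableSpace N] (ι : N → M) : Measure N :=
  vol J fun x v w =>
    g.inner (ι x) (mfderiv J (𝓡∂ n) ι x v) (mfderiv J (𝓡∂ n) ι x w)

/-! ### Operators with boundary conditions -/

/-- A family of operators on `(M, ∂M)`: every metric `g` is given a linear operator `P_g` whose
domain is a linear space of smooth functions on `M` (those that satisfy the boundary condition
belonging to `g`). -/
abbrev OperatorFamily (n : ℕ) [NeZero n] (M : Type*) [TopologicalSpace M]
    [ChartedSpace (EuclideanHalfSpace n) M] [IsManifold (𝓡∂ n) ∞ M] : Type _ :=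
  Metric n M → (Smooth n M →ₗ.[ℝ] Smooth n M)

/-- The space of all `u` in the domain of `T` with `T u = lam u`. -/
def eigenspace (T : Smooth n M →ₗ.[ℝ] Smooth n M) (lam : ℝ) : Submodule ℝ (Smooth n M) :=
  (LinearMap.ker (T.toFun - lam • T.domain.subtype)).map T.domain.subtype

/-- The kernel of `T`. -/
def kernel (T : Smooth n M →ₗ.[ℝ] Smooth n M) : Submodule ℝ (Smooth n M) :=
  (LinearMap.ker T.toFun).map T.domain.subtype

/-- The number of negative eigenvalues, counted with multiplicity. -/
def numNegEigenvalues (T : Smooth n M →ₗ.[ℝ] Smooth n M) : ℕ∞ :=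
  Cardinal.toENat (Module.rank ℝ ↥(⨆ lam : {lam : ℝ // lam < 0}, eigenspace T lam))

/-- Conformal covariance of biweight `(a, b)` on the class `C` of metrics, boundary conditions
included: `P_{e^{2φ}g} = e^{-bφ} P_g e^{aφ}`. -/
def IsConformallyCovariant (P : OperatorFamily n M) (C : Set (Metric n M)) (a b : ℝ) : Prop :=
  ∀ g ∈ C, ∀ g' ∈ C, ∀ φ : Smooth n M, IsConformalChange g g' φ →
    (∀ u : Smooth n M, u ∈ (P g').domain ↔ expMul a φ * u ∈ (P g).domain) ∧
    ∀ (u : (P g').domain) (v : (P g).domain), (v : Smooth n M) = expMul a φ * (u : Smooth n M) →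
      P g' u = expMul (-b) φ * P g v

/-- The kernel transforms by `ker P_{e^{2φ}g} = e^{-(n/2-1)φ} ker P_g`. -/
def KernelTransforms (P : OperatorFamily n M) (C : Set (Metric n M)) : Prop :=
  ∀ g ∈ C, ∀ g' ∈ C, ∀ φ : Smooth n M, IsConformalChange g g' φ →
    (kernel (P g') : Set (Smooth n M)) =
      (fun u => expMul (-((n : ℝ) / 2 - 1)) φ * u) '' (kernel (P g) : Set (Smooth n M))

/-- `P_g` is symmetric in `L²(M, dvol_g)`, with a complete system of eigenfunctions: their linear
combinations are dense in `L²(M, dvol_g)`. -/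
def HasCompleteEigenfunctions [T2Space M] [SigmaCompactSpace M] [MeasurableSpace M]
    (P : OperatorFamily n M) (g : Metric n M) : Prop :=
  (∀ u v : (P g).domain,
    ∫ x, P g u x * (v : Smooth n M) x ∂(volM g) = ∫ x, (u : Smooth n M) x * P g v x ∂(volM g)) ∧
  ∀ f : M → ℝ, MemLp f 2 (volM g) → ∀ ε : ENNReal, 0 < ε →
    ∃ v ∈ ⨆ lam : ℝ, eigenspace (P g) lam, eLpNorm (fun x => f x - v x) 2 (volM g) < ε

/-- The linear map `u ↦ u ∘ j` on smooth functions. -/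
def pullback {X : Type*} (j : X → M) : Smooth n M →ₗ[ℝ] (X → ℝ) where
  toFun u x := u (j x)
  map_add' _ _ := rfl
  map_smul' _ _ := rfl

/-- The space of functions `u ∘ j`, `u ∈ ker P_g`, on a space `X` mapped to `M` by `j`: the kernel
itself for `j = id`, its restriction to `∂M` for the inclusion `j` of `∂M`. -/
def kernelOn (P : OperatorFamily n M) (g : Metric n M) {X : Type*} (j : X → M) :
    Submodule ℝ (X → ℝ) :=
  (kernel (P g)).map (pullback j)

end Manifold

/-! ### Nodal data of a linear space of functions -/

section Nodal

variable {X : Type*}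

/-- The nodal (zero) set of `u`. -/
def nodalSet (u : X → ℝ) : Set X := {x | u x = 0}

/-- The nodal domains of `u`: the connected components of the complement of its nodal set. -/
def nodalDomains [TopologicalSpace X] (u : X → ℝ) : Set (Set X) :=
  {D | ∃ x ∈ (nodalSet u)ᶜ, D = connectedComponentIn (nodalSet u)ᶜ x}

/-- The collection of the nodal sets of the nonzero elements of `K`. -/
def allNodalSets (K : Submodule ℝ (X → ℝ)) : Set (Set X) :=
  {Z | ∃ u ∈ K, u ≠ 0 ∧ Z = nodalSet u}

/-- The collection of the systems of nodal domains of the nonzero elements of `K`. -/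
def allNodalDomains [TopologicalSpace X] (K : Submodule ℝ (X → ℝ)) : Set (Set (Set X)) :=
  {S | ∃ u ∈ K, u ≠ 0 ∧ S = nodalDomains u}

/-- The collection of the non-empty intersections of nodal sets of nonzero elements of `K` and of
complements of such nodal sets. -/
def nodalIntersections (K : Submodule ℝ (X → ℝ)) : Set (Set X) :=
  {Z | Z.Nonempty ∧ ∃ A B : Set (X → ℝ), (∀ u ∈ A, u ∈ K ∧ u ≠ 0) ∧ (∀ v ∈ B, v ∈ K ∧ v ≠ 0) ∧
    (A ∪ B).Nonempty ∧ Z = (⋂ u ∈ A, nodalSet u) ∩ ⋂ v ∈ B, (nodalSet v)ᶜ}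

/-- The collection of the complements of the non-empty intersections of nodal sets of nonzero
elements of `K`. -/
def nodalIntersectionComplements (K : Submodule ℝ (X → ℝ)) : Set (Set X) :=
  {Z | Zᶜ.Nonempty ∧ ∃ A : Set (X → ℝ), (∀ u ∈ A, u ∈ K ∧ u ≠ 0) ∧ A.Nonempty ∧
    Z = (⋂ u ∈ A, nodalSet u)ᶜ}

/-- The common nodal set of `u₁, …, u_k`. -/
def commonNodalSet {k : ℕ} (u : Fin k → X → ℝ) : Set X := ⋂ i, nodalSet (u i)

/-- The map `x ↦ (u₁(x) : … : u_k(x))` to `ℝP^{k-1}`, off the common nodal set. -/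
def projMap {k : ℕ} (u : Fin k → X → ℝ) (x : ↥(commonNodalSet u)ᶜ) : ℙ ℝ (Fin k → ℝ) :=
  Projectivization.mk ℝ (fun i => u i x) fun h =>
    x.2 (Set.mem_iInter.mpr fun i => congrFun h i)

/-- The orbit under `GL_k(ℝ)` of the image of `projMap u`, a collection of subsets of
`ℝP^{k-1}`. -/
def projOrbit {k : ℕ} (u : Fin k → X → ℝ) : Set (Set (ℙ ℝ (Fin k → ℝ))) :=
  MulAction.orbit (GL (Fin k) ℝ) (Set.range (projMap u))

end Nodal

end ConfNodal

end

open ConfNodal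

namespace ConfNodal

/-! ### Nodal data of spaces that differ by a nowhere vanishing factor -/

section NodalTransform

variable {X : Type*}

/-! Except for the count of negative eigenvalues, everything follows from one fact: multiplication
by a positive function carries `ker P_g` onto `ker P_{g'}` (`isMulTransform_kernelOn`). Such a
factor is invertible and changes no zero set, so dimensions, nodal sets, nodal domains and their
intersections agree. Bases of the two kernels differ by a constant invertible matrix and a scalar
depending on the point (`IsMulTransform.exists_matrix`), and the scalar disappears in projective
space. Composing with a map `X → M` commutes with multiplication, so the boundary needs no separate
argument.

The measure identities are a cancellation of weights: the volume of a `d`-dimensional submanifold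
scales by `e^{dφ}` (`vol_conformal`), while `|u|^p` scales by `e^{-(n/2-1)pφ}`, and `(n/2-1)p = d`.

For the negative eigenvalues, let `E` and `E'` be the spans of the eigenfunctions with negative
eigenvalue for `g` and `g'`. Pair `w ∈ E` with `z ∈ E'` by `⟨e^{-aφ}w, z⟩` in `L²(dvol_{g'})`. If
`w` pairs to zero with all of `E'`, completeness for `g'` makes the quadratic form of `P_{g'}`
nonnegative at `e^{-aφ}w` (`inner_nonneg_of_orthogonal`). By covariance that form is diagonal on the
eigenfunction components of `w`, with negative entries, so `w = 0` (`eq_zero_of_inner_nonneg`). Thus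
`E` embeds in the dual of `E'`, which bounds its dimension; exchanging the metrics gives equality.
The pairing argument needs `dvol_{g'}` to be finite and to charge open sets, which is proved from
its chart description. -/

/-- Multiplication by the nowhere vanishing function `m` maps `K` onto `K'`. -/
structure IsMulTransform (m : X → ℝ) (K K' : Submodule ℝ (X → ℝ)) : Prop where
  ne_zero : ∀ x, m x ≠ 0
  mul_mem : ∀ u ∈ K, m * u ∈ K'
  inv_mul_mem : ∀ v ∈ K', m⁻¹ * v ∈ K

theorem IsMulTransform.symm {m : X → ℝ} {K K' : Submodule ℝ (X → ℝ)}
    (h : IsMulTransform m K K') : IsMulTransform m⁻¹ K' K where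
  ne_zero x := inv_ne_zero (h.ne_zero x)
  mul_mem := h.inv_mul_mem
  inv_mul_mem := by simpa using h.mul_mem

theorem mul_inv_mul_cancel_of_ne_zero {m : X → ℝ} (hm : ∀ x, m x ≠ 0) (u : X → ℝ) :
    m * (m⁻¹ * u) = u := by
  ext x
  simp [hm x]

theorem inv_mul_mul_cancel_of_ne_zero {m : X → ℝ} (hm : ∀ x, m x ≠ 0) (u : X → ℝ) :
    m⁻¹ * (m * u) = u := by
  ext x
  simp [hm x]

theorem nodalSet_mul {m : X → ℝ} (hm : ∀ x, m x ≠ 0) (u : X → ℝ) :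
    nodalSet (m * u) = nodalSet u := by
  ext x
  simp [nodalSet, hm x]

theorem nodalDomains_congr [TopologicalSpace X] {u v : X → ℝ} (h : nodalSet u = nodalSet v) :
    nodalDomains u = nodalDomains v := by
  simp [nodalDomains, h]

theorem nodalDomains_mul [TopologicalSpace X] {m : X → ℝ} (hm : ∀ x, m x ≠ 0) (u : X → ℝ) :
    nodalDomains (m * u) = nodalDomains u :=
  nodalDomains_congr (nodalSet_mul hm u)

theorem mul_ne_zero_of_ne_zero {m : X → ℝ} (hm : ∀ x, m x ≠ 0) {u : X → ℝ} (hu : u ≠ 0) :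
    m * u ≠ 0 := fun h => hu <| by
  rw [← inv_mul_mul_cancel_of_ne_zero hm u, h, mul_zero]

namespace IsMulTransform

variable {m : X → ℝ} {K K' : Submodule ℝ (X → ℝ)}

/-- Multiplication by `m` as a linear equivalence. -/
noncomputable def linearEquiv (h : IsMulTransform m K K') : K ≃ₗ[ℝ] K' where
  toFun u := ⟨m * u, h.mul_mem u u.2⟩
  map_add' u v := by ext; simp [mul_add]
  map_smul' c u := by ext; simp [mul_left_comm]
  invFun v := ⟨m⁻¹ * v, h.inv_mul_mem v v.2⟩
  left_inv u := by ext1; exact inv_mul_mul_cancel_of_ne_zero h.ne_zero _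
  right_inv v := by ext1; exact mul_inv_mul_cancel_of_ne_zero h.ne_zero _

theorem rank_eq (h : IsMulTransform m K K') : Module.rank ℝ K' = Module.rank ℝ K :=
  h.linearEquiv.rank_eq.symm

theorem allNodalSets_subset (h : IsMulTransform m K K') : allNodalSets K ⊆ allNodalSets K' := by
  rintro _ ⟨u, hu, hu0, rfl⟩
  exact ⟨m * u, h.mul_mem u hu, mul_ne_zero_of_ne_zero h.ne_zero hu0,
    (nodalSet_mul h.ne_zero u).symm⟩

theorem allNodalSets_eq (h : IsMulTransform m K K') : allNodalSets K' = allNodalSets K :=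
  h.symm.allNodalSets_subset.antisymm h.allNodalSets_subset

theorem allNodalDomains_subset [TopologicalSpace X] (h : IsMulTransform m K K') :
    allNodalDomains K ⊆ allNodalDomains K' := by
  rintro _ ⟨u, hu, hu0, rfl⟩
  exact ⟨m * u, h.mul_mem u hu, mul_ne_zero_of_ne_zero h.ne_zero hu0,
    (nodalDomains_mul h.ne_zero u).symm⟩

theorem allNodalDomains_eq [TopologicalSpace X] (h : IsMulTransform m K K') :
    allNodalDomains K' = allNodalDomains K :=
  h.symm.allNodalDomains_subset.antisymm h.allNodalDomains_subset

theorem image_mem (h : IsMulTransform m K K') {A : Set (X → ℝ)} (hA : ∀ u ∈ A, u ∈ K ∧ u ≠ 0) :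
    ∀ v ∈ (m * ·) '' A, v ∈ K' ∧ v ≠ 0 := by
  rintro _ ⟨u, hu, rfl⟩
  exact ⟨h.mul_mem u (hA u hu).1, mul_ne_zero_of_ne_zero h.ne_zero (hA u hu).2⟩

theorem nodalIntersections_subset (h : IsMulTransform m K K') :
    nodalIntersections K ⊆ nodalIntersections K' := by
  rintro Z ⟨hZ, A, B, hA, hB, hAB, rfl⟩
  refine ⟨hZ, (m * ·) '' A, (m * ·) '' B, h.image_mem hA, h.image_mem hB, ?_, ?_⟩
  · rw [← Set.image_union]
    exact hAB.image _
  · simp only [Set.biInter_image, nodalSet_mul h.ne_zero]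

theorem nodalIntersections_eq (h : IsMulTransform m K K') :
    nodalIntersections K' = nodalIntersections K :=
  h.symm.nodalIntersections_subset.antisymm h.nodalIntersections_subset

theorem nodalIntersectionComplements_subset (h : IsMulTransform m K K') :
    nodalIntersectionComplements K ⊆ nodalIntersectionComplements K' := by
  rintro Z ⟨hZ, A, hA, hA0, rfl⟩
  refine ⟨hZ, (m * ·) '' A, h.image_mem hA, hA0.image _, ?_⟩
  simp only [Set.biInter_image, nodalSet_mul h.ne_zero]

theorem nodalIntersectionComplements_eq (h : IsMulTransform m K K') :
    nodalIntersectionComplements K' = nodalIntersectionComplements K :=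
  h.symm.nodalIntersectionComplements_subset.antisymm h.nodalIntersectionComplements_subset

/-- Bases of `K` and `K'` are related by an invertible matrix. -/
theorem exists_matrix (h : IsMulTransform m K K') {k : ℕ} (u : Module.Basis (Fin k) ℝ K)
    (u' : Module.Basis (Fin k) ℝ K') :
    ∃ A : GL (Fin k) ℝ, ∀ x, (fun i => (u' i : X → ℝ) x) =
      m x • (A • fun i => (u i : X → ℝ) x) := by
  -- The transported basis `w i = m * u i` lies in the same space as `u'`. Change-of-basis
  -- coefficients sit in columns, so the matrix acting on the vector of values is the transpose.
  let w : Module.Basis (Fin k) ℝ K' := u.map h.linearEquiv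
  let A : GL (Fin k) ℝ :=
    ⟨(w.toMatrix u').transpose, (u'.toMatrix w).transpose,
      by rw [← Matrix.transpose_mul, Module.Basis.toMatrix_mul_toMatrix_flip,
        Matrix.transpose_one],
      by rw [← Matrix.transpose_mul, Module.Basis.toMatrix_mul_toMatrix_flip,
        Matrix.transpose_one]⟩
  refine ⟨A, fun x => funext fun i => ?_⟩
  have key : ∑ j, w.toMatrix u' j i • w j = u' i := w.sum_toMatrix_smul_self u' i
  have key' := congrFun (congrArg (Subtype.val : K' → X → ℝ) key) x
  rw [← key']
  change _ = m x * ((w.toMatrix u').transpose.mulVec fun i => (u i : X → ℝ) x) i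
  rw [Submodule.coe_sum, Finset.sum_apply, Matrix.mulVec, dotProduct, Finset.mul_sum]
  refine Finset.sum_congr rfl fun j _ => ?_
  change w.toMatrix u' j i * (m x * (u j : X → ℝ) x) = _
  rw [Matrix.transpose_apply]
  ring

end IsMulTransform

/-! ### Projective maps of families related by a matrix and a scalar -/

section ProjMap

variable {k : ℕ} {u u' : Fin k → X → ℝ} {m : X → ℝ} {A : GL (Fin k) ℝ}

theorem mem_commonNodalSet_iff {x : X} : x ∈ commonNodalSet u ↔ (fun i => u i x) = 0 := by
  simp [commonNodalSet, nodalSet, funext_iff]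

theorem commonNodalSet_eq (hm : ∀ x, m x ≠ 0)
    (h : ∀ x, (fun i => u' i x) = m x • (A • fun i => u i x)) :
    commonNodalSet u' = commonNodalSet u := by
  ext x
  rw [mem_commonNodalSet_iff, mem_commonNodalSet_iff, h, smul_eq_zero_iff_right (hm x),
    smul_eq_zero_iff_eq]

theorem projMap_eq_smul
    (h : ∀ x, (fun i => u' i x) = m x • (A • fun i => u i x)) (x : X)
    (hx : x ∈ (commonNodalSet u)ᶜ) (hx' : x ∈ (commonNodalSet u')ᶜ) :
    projMap u' ⟨x, hx'⟩ = A • projMap u ⟨x, hx⟩ := by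
  unfold projMap
  rw [Projectivization.smul_mk, Projectivization.mk_eq_mk_iff']
  exact ⟨m x, (h x).symm⟩

theorem projOrbit_eq (hm : ∀ x, m x ≠ 0)
    (h : ∀ x, (fun i => u' i x) = m x • (A • fun i => u i x)) :
    projOrbit u' = projOrbit u := by
  have hr : Set.range (projMap u') = A • Set.range (projMap u) := by
    have hc := commonNodalSet_eq hm h
    ext q
    rw [Set.mem_smul_set]
    constructor
    · rintro ⟨⟨x, hx⟩, rfl⟩
      exact ⟨_, ⟨⟨x, hc ▸ hx⟩, rfl⟩, (projMap_eq_smul h x _ _).symm⟩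
    · rintro ⟨_, ⟨⟨x, hx⟩, rfl⟩, rfl⟩
      exact ⟨⟨x, hc.symm ▸ hx⟩, projMap_eq_smul h x _ _⟩
  rw [projOrbit, hr, MulAction.orbit_smul, projOrbit]

end ProjMap

end NodalTransform

end ConfNodal

namespace ConfNodal

/-! ### The Riemannian volume measure -/

section Volume

/-- A.e. measurability suffices for `T`; this matters because inverse charts are controlled only on
the chart target. -/
theorem withDensity_map_eq {α β : Type*} [MeasurableSpace α] [MeasurableSpace β] {μ : Measure α}
    {T : α → β} (hT : AEMeasurable T μ) {q : β → ENNReal} (hq : Measurable q) :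
    (μ.map T).withDensity q = (μ.withDensity (q ∘ T)).map T := by
  have hT' : AEMeasurable T (μ.withDensity (q ∘ T)) :=
    hT.mono_ac (withDensity_absolutelyContinuous _ _)
  ext s hs
  have hTs : NullMeasurableSet (T ⁻¹' s) μ := hT.nullMeasurable hs
  rw [withDensity_apply _ hs, Measure.map_apply_of_aemeasurable hT' hs,
    withDensity_apply₀ _ hTs, Measure.restrict_map_of_aemeasurable hT hs,
    lintegral_map' hq.aemeasurable (hT.mono_measure Measure.restrict_le_self)]
  rfl

/-- The matrix is the Gram matrix of the pullback of `B` under `D`, and injectivity of `D` keeps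
this pullback positive definite. -/
theorem det_gram_pos {d : ℕ} {F : Type*} [NormedAddCommGroup F] [NormedSpace ℝ F]
    (B : F →L[ℝ] F →L[ℝ] ℝ) (hs : ∀ v w, B v w = B w v) (hB : ∀ v, v ≠ 0 → 0 < B v v)
    (D : EuclideanSpace ℝ (Fin d) →L[ℝ] F) (hD : Function.Injective D) :
    0 < Matrix.det (Matrix.of fun i j : Fin d =>
      B (D (EuclideanSpace.single i (1 : ℝ))) (D (EuclideanSpace.single j (1 : ℝ)))) := by
  refine (Matrix.PosDef.of_dotProduct_mulVec_pos ?_ fun x hx => ?_).det_pos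
  · ext i j
    simp only [Matrix.conjTranspose_apply, Matrix.of_apply, star_trivial]
    exact hs _ _
  · have hv : (WithLp.toLp 2 x : EuclideanSpace ℝ (Fin d)) =
        ∑ i, x i • EuclideanSpace.single i (1 : ℝ) := by
      ext j
      simp [Pi.single_apply]
    have h0 : D (WithLp.toLp 2 x) ≠ 0 := fun h => hx <| by
      have := hD (h.trans (map_zero D).symm)
      simpa using congrArg WithLp.ofLp this
    have key : star x ⬝ᵥ (Matrix.of fun i j : Fin d => B (D (EuclideanSpace.single i (1 : ℝ)))
        (D (EuclideanSpace.single j (1 : ℝ)))).mulVec x =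
        B (D (WithLp.toLp 2 x)) (D (WithLp.toLp 2 x)) := by
      rw [hv]
      simp only [map_sum, map_smul, dotProduct, Matrix.mulVec, star_trivial, Matrix.of_apply,
        sum_apply, smul_apply, smul_eq_mul,
        Finset.mul_sum]
      rw [Finset.sum_comm]
      refine Finset.sum_congr rfl fun i _ => Finset.sum_congr rfl fun j _ => ?_
      ring
    rw [key]
    exact hB _ h0

variable {d : ℕ} {H : Type*} [TopologicalSpace H]
  {I : ModelWithCorners ℝ (EuclideanSpace ℝ (Fin d)) H}
  {N : Type*} [TopologicalSpace N] [ChartedSpace H N]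

theorem measurableSet_extChartAt_target (c : N) : MeasurableSet (extChartAt I c).target := by
  rw [extChartAt_target]
  exact ((chartAt H c).open_target.preimage I.continuous_symm).measurableSet.inter
    I.isClosed_range.measurableSet

theorem aemeasurable_extChartAt_symm [MeasurableSpace N] [BorelSpace N] (c : N) :
    AEMeasurable (extChartAt I c).symm (volume.restrict (extChartAt I c).target) :=
  (continuousOn_extChartAt_symm c).aemeasurable (measurableSet_extChartAt_target c)

theorem aemeasurable_extChartAt_symm_withDensity [MeasurableSpace N] [BorelSpace N] (c : N)
    (s : EuclideanSpace ℝ (Fin d) → ENNReal) :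
    AEMeasurable (extChartAt I c).symm
      ((volume.restrict (extChartAt I c).target).withDensity s) :=
  (aemeasurable_extChartAt_symm c).mono_ac (withDensity_absolutelyContinuous _ _)

theorem sqrtDet_nonneg (h : ∀ x : N, TangentSpace I x → TangentSpace I x → ℝ) (c : N)
    (y : EuclideanSpace ℝ (Fin d)) : 0 ≤ sqrtDet I h c y :=
  Real.sqrt_nonneg _

/-- A factor `e^{2ψ}` on a `d × d` matrix multiplies its determinant by `e^{2dψ}`; the square root
halves the exponent. -/
theorem sqrtDet_smul {h h' : ∀ x : N, TangentSpace I x → TangentSpace I x → ℝ} {ψ : N → ℝ}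
    (hh : ∀ x v w, h' x v w = Real.exp (2 * ψ x) * h x v w) (c : N)
    (y : EuclideanSpace ℝ (Fin d)) :
    sqrtDet I h' c y = sqrtDet I h c y * Real.exp (d * ψ ((extChartAt I c).symm y)) := by
  have he : ∀ t : ℝ, Real.exp (2 * t) ^ d = Real.exp (d * t) ^ 2 := fun t => by
    rw [← Real.exp_nat_mul, ← Real.exp_nat_mul]
    congr 1
    push_cast
    ring
  unfold sqrtDet
  simp only [hh]
  rw [show (Matrix.of fun i j : Fin d => Real.exp (2 * ψ ((extChartAt I c).symm y)) *
        h ((extChartAt I c).symm y) (coordVec I c y i) (coordVec I c y j)) =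
      Real.exp (2 * ψ ((extChartAt I c).symm y)) • Matrix.of fun i j : Fin d =>
        h ((extChartAt I c).symm y) (coordVec I c y i) (coordVec I c y j) from rfl,
    Matrix.det_smul, Fintype.card_fin, he, Real.sqrt_mul (sq_nonneg _),
    Real.sqrt_sq (Real.exp_pos _).le, mul_comm]

/-! ### Conformal scaling, finiteness and positivity of the volume -/

section Measure

variable [MeasurableSpace N] [BorelSpace N]
  {h h' : ∀ x : N, TangentSpace I x → TangentSpace I x → ℝ} {ψ : N → ℝ}

theorem chartVol_conformal (c : N) (hc : ContinuousOn (sqrtDet I h c) (extChartAt I c).target)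
    (hψ : Continuous ψ) (hh : ∀ x v w, h' x v w = Real.exp (2 * ψ x) * h x v w) :
    chartVol I h' c =
      (chartVol I h c).withDensity fun x => ENNReal.ofReal (Real.exp (d * ψ x)) := by
  have hq : Measurable fun x => ENNReal.ofReal (Real.exp (d * ψ x)) := by fun_prop
  have hs : AEMeasurable (fun y => ENNReal.ofReal (sqrtDet I h c y))
      (volume.restrict (extChartAt I c).target) :=
    (hc.aemeasurable (measurableSet_extChartAt_target c)).ennreal_ofReal
  rw [chartVol, chartVol, withDensity_map_eq (aemeasurable_extChartAt_symm_withDensity c _) hq,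
    ← withDensity_mul₀ hs (hq.comp_aemeasurable (aemeasurable_extChartAt_symm c))]
  congr 2
  ext y
  rw [sqrtDet_smul hh, ENNReal.ofReal_mul (sqrtDet_nonneg _ _ _)]
  rfl

/-- The coordinate image of `K` is compact inside the chart target, where the continuous density is
bounded. -/
theorem chartVol_lt_top_of_isCompact [T2Space N] {c : N}
    (hc : ContinuousOn (sqrtDet I h c) (extChartAt I c).target) {K : Set N} (hK : IsCompact K)
    (hKc : K ⊆ (extChartAt I c).source) : chartVol I h c K < ⊤ := by
  have hK' : IsCompact (extChartAt I c '' K) :=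
    hK.image_of_continuousOn ((continuousOn_extChartAt c).mono hKc)
  have hsub : extChartAt I c '' K ⊆ (extChartAt I c).target :=
    Set.image_subset_iff.mpr fun x hx => (extChartAt I c).map_source (hKc hx)
  obtain ⟨R, hR⟩ := hK'.exists_bound_of_continuousOn (hc.mono hsub)
  have hpre : (extChartAt I c).symm ⁻¹' K ∩ (extChartAt I c).target ⊆ extChartAt I c '' K :=
    fun y hy => ⟨_, hy.1, (extChartAt I c).right_inv hy.2⟩
  rw [chartVol, Measure.map_apply_of_aemeasurable (aemeasurable_extChartAt_symm_withDensity c _)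
    hK.isClosed.measurableSet, withDensity_apply₀ _ ((aemeasurable_extChartAt_symm c).nullMeasurable
      hK.isClosed.measurableSet), Measure.restrict_restrict₀
      ((aemeasurable_extChartAt_symm c).nullMeasurable hK.isClosed.measurableSet)]
  calc _ ≤ ∫⁻ y in extChartAt I c '' K, ENNReal.ofReal (sqrtDet I h c y) :=
        lintegral_mono_set hpre
    _ ≤ ∫⁻ _ in extChartAt I c '' K, ENNReal.ofReal R :=
        setLIntegral_mono' hK'.isClosed.measurableSet fun y hy =>
          ENNReal.ofReal_le_ofReal ((le_abs_self _).trans (hR y hy))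
    _ < ⊤ := by
        rw [setLIntegral_const]
        exact ENNReal.mul_lt_top ENNReal.ofReal_lt_top hK'.measure_lt_top

variable [IsManifold I ∞ N] [T2Space N] [SigmaCompactSpace N]

variable (I) in
theorem measurable_chartPartition (c : N) :
    Measurable fun x => ENNReal.ofReal (chartPartition I N c x) :=
  (chartPartition I N c).contMDiff.continuous.measurable.ennreal_ofReal

theorem vol_conformal (hc : ∀ c, ContinuousOn (sqrtDet I h c) (extChartAt I c).target)
    (hψ : Continuous ψ) (hh : ∀ x v w, h' x v w = Real.exp (2 * ψ x) * h x v w) :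
    vol I h' = (vol I h).withDensity fun x => ENNReal.ofReal (Real.exp (d * ψ x)) := by
  have hq : Measurable fun x => ENNReal.ofReal (Real.exp (d * ψ x)) := by fun_prop
  rw [vol, vol, withDensity_sum]
  congr 1
  ext1 c
  rw [chartVol_conformal c (hc c) hψ hh, ← withDensity_mul _ hq (measurable_chartPartition I c),
    mul_comm, withDensity_mul _ (measurable_chartPartition I c) hq]

/-- By compactness only finitely many partition functions are nonzero. Each is at most `1` with
compact support inside its chart, so each term is finite. -/
theorem isFiniteMeasure_vol [CompactSpace N]
    (hc : ∀ c, ContinuousOn (sqrtDet I h c) (extChartAt I c).target) :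
    IsFiniteMeasure (vol I h) := by
  have hfin : {c | (Function.support (chartPartition I N c)).Nonempty}.Finite :=
    (chartPartition I N).locallyFinite.finite_nonempty_of_compact
  have hsubord : ∀ c, tsupport (chartPartition I N c) ⊆ (extChartAt I c).source := fun c => by
    rw [extChartAt_source]
    exact (SmoothPartitionOfUnity.exists_isSubordinate_chartAt_source I N).choose_spec c
  have hone : ∀ c, ((chartVol I h c).withDensity
      fun x => ENNReal.ofReal (chartPartition I N c x)) Set.univ < ⊤ := fun c => by
    rw [withDensity_apply _ MeasurableSet.univ, setLIntegral_univ]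
    calc _ ≤ ∫⁻ x, (tsupport (chartPartition I N c)).indicator (fun _ => 1) x
          ∂(chartVol I h c) := lintegral_mono fun x => by
            by_cases hx : x ∈ tsupport (chartPartition I N c)
            · rw [Set.indicator_of_mem hx]
              exact ENNReal.ofReal_le_one.mpr ((chartPartition I N).le_one c x)
            · simp [image_eq_zero_of_notMem_tsupport hx]
      _ = chartVol I h c (tsupport (chartPartition I N c)) :=
          lintegral_indicator_one (isClosed_tsupport _).measurableSet
      _ < ⊤ := chartVol_lt_top_of_isCompact (hc c) (isClosed_tsupport _).isCompact (hsubord c)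
  refine ⟨?_⟩
  rw [vol, Measure.sum_apply _ MeasurableSet.univ,
    tsum_eq_sum (s := hfin.toFinset) fun c hcs => ?_]
  · exact ENNReal.sum_lt_top.mpr fun c _ => hone c
  · have h0 : (chartPartition I N c : N → ℝ) = 0 := by
      simpa [Set.not_nonempty_iff_eq_empty] using hcs
    simp [h0]

/-- Near any point some partition function is positive. If the volume of `U` vanished, the positive
density `sqrtDet` would be zero a.e. on a coordinate set with nonempty interior. -/
theorem isOpenPosMeasure_vol
    (hpos : ∀ c, ∀ y ∈ (extChartAt I c).target, 0 < sqrtDet I h c y)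
    (hc : ∀ c, ContinuousOn (sqrtDet I h c) (extChartAt I c).target) :
    (vol I h).IsOpenPosMeasure := by
  refine ⟨fun U hU ⟨x, hx⟩ h0 => ?_⟩
  obtain ⟨c, hcx⟩ := (chartPartition I N).exists_pos_of_mem (Set.mem_univ x)
  have hsubord : tsupport (chartPartition I N c) ⊆ (extChartAt I c).source := by
    rw [extChartAt_source]
    exact (SmoothPartitionOfUnity.exists_isSubordinate_chartAt_source I N).choose_spec c
  have hxs : x ∈ (extChartAt I c).source :=
    hsubord (subset_tsupport _ (Function.mem_support.mpr hcx.ne'))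
  rw [vol, Measure.sum_apply _ hU.measurableSet, ENNReal.tsum_eq_zero] at h0
  have h1 := (withDensity_apply_eq_zero (measurable_chartPartition I c)).mp (h0 c)
  set W : Set N := {x | ENNReal.ofReal (chartPartition I N c x) ≠ 0} ∩ U with hW
  have hWo : IsOpen W := by
    refine IsOpen.inter ?_ hU
    have : {x | ENNReal.ofReal (chartPartition I N c x) ≠ 0} =
        {x | 0 < chartPartition I N c x} := by
      ext; simp
    rw [this]
    exact isOpen_lt continuous_const (chartPartition I N c).contMDiff.continuous
  have hxW : x ∈ W := ⟨by simpa using hcx, hx⟩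
  have hTW := (aemeasurable_extChartAt_symm (I := I) c).nullMeasurable hWo.measurableSet
  rw [chartVol, Measure.map_apply_of_aemeasurable (aemeasurable_extChartAt_symm_withDensity c _)
    hWo.measurableSet, withDensity_apply₀ _ hTW, Measure.restrict_restrict₀ hTW,
    lintegral_eq_zero_iff'] at h1
  · set S := (extChartAt I c).symm ⁻¹' W ∩ (extChartAt I c).target with hS
    -- At a boundary point `S` need not be a neighbourhood in Euclidean space, but the coordinates
    -- of `x` still lie in the closure of its interior.
    have hne : (interior S).Nonempty := by
      have := extChartAt_mem_closure_interior (I := I) (s := W) (x₀ := c)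
        (subset_closure (hWo.interior_eq.symm ▸ hxW)) hxs
      exact closure_nonempty_iff.mp ⟨_, this⟩
    have hi := ae_mono (Measure.restrict_mono_set volume (interior_subset : interior S ⊆ S)) h1
    have hi' : ∀ᵐ _ ∂(volume.restrict (interior S)), False := by
      filter_upwards [hi, ae_restrict_mem isOpen_interior.measurableSet] with y hy hyS
      have := hpos c y (interior_subset hyS).2
      simp only [Pi.zero_apply, ENNReal.ofReal_eq_zero] at hy
      exact this.not_ge hy
    rw [Filter.eventually_false_iff_eq_bot, ae_eq_bot, Measure.restrict_eq_zero] at hi'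
    exact (isOpen_interior.measure_pos volume hne).ne' hi'
  · exact ((hc c).aemeasurable (measurableSet_extChartAt_target c)).ennreal_ofReal.mono_measure
      (Measure.restrict_mono_set volume Set.inter_subset_right)

end Measure

/-! ### Continuity and positivity of the density of a Riemannian metric -/

section Continuity

theorem continuousOn_coordVec [IsManifold I ∞ N] (c : N) (i : Fin d) :
    ContinuousOn (fun y => (⟨(extChartAt I c).symm y, coordVec I c y i⟩ : TangentBundle I N))
      (extChartAt I c).target := by
  have h1 : ContinuousOn (tangentMapWithin 𝓘(ℝ, EuclideanSpace ℝ (Fin d)) I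
      (extChartAt I c).symm (extChartAt I c).target) _ :=
    (contMDiffOn_extChartAt_symm (n := ∞) c).continuousOn_tangentMapWithin (by simp)
      (uniqueMDiffOn_iff_uniqueDiffOn.mpr (uniqueDiffOn_extChartAt_target c))
  have h2 : Continuous fun y : EuclideanSpace ℝ (Fin d) =>
      (⟨y, EuclideanSpace.single i (1 : ℝ)⟩ :
        TangentBundle 𝓘(ℝ, EuclideanSpace ℝ (Fin d)) (EuclideanSpace ℝ (Fin d))) :=
    (tangentBundleModelSpaceHomeomorph 𝓘(ℝ, EuclideanSpace ℝ (Fin d))).symm.continuous.comp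
      (continuous_id.prodMk continuous_const)
  refine (h1.comp h2.continuousOn fun y hy => hy).congr fun y hy => ?_
  -- The range of `I` and the chart target agree near `y`, so derivatives within them coincide.
  have h3 : mfderivWithin 𝓘(ℝ, EuclideanSpace ℝ (Fin d)) I (extChartAt I c).symm
      (Set.range I) y = mfderivWithin 𝓘(ℝ, EuclideanSpace ℝ (Fin d)) I (extChartAt I c).symm
      (extChartAt I c).target y :=
    mfderivWithin_congr_set (extChartAt_target_eventuallyEq_of_mem hy).symm
  simp only [coordVec, tangentMapWithin, Function.comp_apply, h3]

variable {n : ℕ} [NeZero n] {M : Type*} [TopologicalSpace M]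
  [ChartedSpace (EuclideanHalfSpace n) M] [IsManifold (𝓡∂ n) ∞ M]

theorem continuousOn_metric_inner (g : Metric n M) {Y : Type*} [TopologicalSpace Y] {s : Set Y}
    {β : Y → M} {v w : ∀ y, TangentSpace (𝓡∂ n) (β y)}
    (hv : ContinuousOn (fun y => (⟨β y, v y⟩ : TangentBundle (𝓡∂ n) M)) s)
    (hw : ContinuousOn (fun y => (⟨β y, w y⟩ : TangentBundle (𝓡∂ n) M)) s) :
    ContinuousOn (fun y => g.inner (β y) (v y) (w y)) s := by
  intro y hy
  have hβ : ContinuousWithinAt β s y :=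
    (FiberBundle.continuous_proj (EuclideanSpace ℝ (Fin n))
      (TangentSpace (𝓡∂ n) : M → Type _)).continuousAt.comp_continuousWithinAt (hv y hy)
  have h : ContinuousWithinAt (fun y => Bundle.TotalSpace.mk' ℝ (E := Bundle.Trivial M ℝ) (β y)
      (g.inner (β y) (v y) (w y))) s y :=
    (g.contMDiff.continuous.continuousAt.comp_continuousWithinAt hβ).clm_bundle_apply₂
      (F₁ := EuclideanSpace ℝ (Fin n)) (F₂ := EuclideanSpace ℝ (Fin n)) (hv y hy) (hw y hy)
  simp only [FiberBundle.continuousWithinAt_totalSpace] at h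
  exact h.2

theorem continuousOn_sqrtDet_pullback [IsManifold I ∞ N] (g : Metric n M) {ι : N → M}
    (hι : ContMDiff I (𝓡∂ n) ∞ ι) (c : N) :
    ContinuousOn (sqrtDet I (fun x v w =>
      g.inner (ι x) (mfderiv I (𝓡∂ n) ι x v) (mfderiv I (𝓡∂ n) ι x w)) c)
      (extChartAt I c).target := by
  have h1 : ∀ i, ContinuousOn (fun y => (⟨ι ((extChartAt I c).symm y),
      mfderiv I (𝓡∂ n) ι ((extChartAt I c).symm y) (coordVec I c y i)⟩ :
        TangentBundle (𝓡∂ n) M)) (extChartAt I c).target := fun i =>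
    (hι.continuous_tangentMap (by simp)).comp_continuousOn (continuousOn_coordVec c i)
  have hdet : Continuous fun A : Matrix (Fin d) (Fin d) ℝ => Real.sqrt A.det := by fun_prop
  refine hdet.comp_continuousOn ?_
  exact continuousOn_pi.mpr fun i => continuousOn_pi.mpr fun j =>
    continuousOn_metric_inner g (h1 i) (h1 j)

theorem volSub_conformal [IsManifold I ∞ N] [T2Space N] [SigmaCompactSpace N] [MeasurableSpace N]
    [BorelSpace N] {g g' : Metric n M} {φ : Smooth n M} (hφ : IsConformalChange g g' φ)
    {ι : N → M} (hι : ContMDiff I (𝓡∂ n) ∞ ι) :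
    volSub g' I ι =
      (volSub g I ι).withDensity fun x => ENNReal.ofReal (Real.exp (d * φ (ι x))) :=
  vol_conformal (ψ := fun x => φ (ι x)) (continuousOn_sqrtDet_pullback g hι)
    (φ.contMDiff.continuous.comp hι.continuous) fun _ _ _ => hφ _ _ _

theorem sqrtDet_pos (g : Metric n M) (c : M) (y : EuclideanSpace ℝ (Fin n))
    (hy : y ∈ (extChartAt (𝓡∂ n) c).target) :
    0 < sqrtDet (𝓡∂ n) (fun x v w => g.inner x v w) c y :=
  Real.sqrt_pos.mpr <| det_gram_pos (F := EuclideanSpace ℝ (Fin n))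
    (g.inner ((extChartAt (𝓡∂ n) c).symm y)) (g.symm _) (g.pos _) _
    (isInvertible_mfderivWithin_extChartAt_symm hy).injective

theorem continuousOn_sqrtDet (g : Metric n M) (c : M) :
    ContinuousOn (sqrtDet (𝓡∂ n) (fun x v w => g.inner x v w) c)
      (extChartAt (𝓡∂ n) c).target := by
  have h := continuousOn_sqrtDet_pullback g (contMDiff_id (I := 𝓡∂ n) (M := M)) c
  simp only [mfderiv_id] at h
  exact h

variable [T2Space M] [MeasurableSpace M]

theorem volM_eq_volSub [SigmaCompactSpace M] (g : Metric n M) :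
    volM g = volSub g (𝓡∂ n) (id : M → M) := by
  simp only [volM, volSub, mfderiv_id]
  rfl

instance isFiniteMeasure_volM [CompactSpace M] [BorelSpace M] (g : Metric n M) :
    IsFiniteMeasure (volM g) :=
  isFiniteMeasure_vol (continuousOn_sqrtDet g)

instance isOpenPosMeasure_volM [SigmaCompactSpace M] [BorelSpace M] (g : Metric n M) :
    (volM g).IsOpenPosMeasure :=
  isOpenPosMeasure_vol (sqrtDet_pos g) (continuousOn_sqrtDet g)

end Continuity

end Volume

end ConfNodal

namespace ConfNodal

/-! ### The number of negative eigenvalues -/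

section Spectral

universe u

open scoped RealInnerProductSpace

/-- A finite-dimensional space has the dimension of its dual. In infinite dimension the dual may be
larger, but `toENat` sends every infinite rank to `⊤`. -/
theorem toENat_rank_le_of_injective_dual {V W : Type u} [AddCommGroup V] [Module ℝ V]
    [AddCommGroup W] [Module ℝ W] (f : V →ₗ[ℝ] Module.Dual ℝ W) (hf : Function.Injective f) :
    Cardinal.toENat (Module.rank ℝ V) ≤ Cardinal.toENat (Module.rank ℝ W) := by
  by_cases hW : Module.Finite ℝ W
  · have h := LinearMap.rank_le_of_injective f hf
    rw [← Module.finrank_eq_rank ℝ (Module.Dual ℝ W), Subspace.dual_finrank_eq,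
      Module.finrank_eq_rank ℝ W] at h
    exact OrderHomClass.mono Cardinal.toENat h
  · rw [Cardinal.toENat_eq_top.mpr (not_lt.mp fun h => hW (Module.rank_lt_aleph0_iff.mp h))]
    exact le_top

variable {V H : Type*} [AddCommGroup V] [Module ℝ V] [NormedAddCommGroup H]
  [InnerProductSpace ℝ H] {J : V →ₗ[ℝ] H} {T T' : V →ₗ.[ℝ] V}

theorem inner_eigenvector_eq_zero (hsymm : ∀ u v : T.domain, ⟪J (T u), J v⟫ = ⟪J u, J (T v)⟫)
    {lam mu : ℝ} (hne : lam ≠ mu) {u v : T.domain} (hu : T u = lam • (u : V))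
    (hv : T v = mu • (v : V)) : ⟪J u, J v⟫ = 0 := by
  have h := hsymm u v
  rw [hu, hv, map_smul, map_smul, real_inner_smul_left, real_inner_smul_right] at h
  have h' : (lam - mu) * ⟪J u, J v⟫ = 0 := by rw [sub_mul, h, sub_self]
  exact (mul_eq_zero.mp h').resolve_left (sub_ne_zero.mpr hne)

/-- The best approximation of `x` by combinations of orthogonal vectors. -/
theorem norm_sub_sum_proj_le {ι : Type*} (s : Finset ι) (z : ι → H)
    (hz : ∀ i j, i ≠ j → ⟪z i, z j⟫ = 0) (x : H) :
    ‖x - ∑ i ∈ s, (⟪x, z i⟫ / ‖z i‖ ^ 2) • z i‖ ≤ ‖x - ∑ i ∈ s, z i‖ := by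
  set p := ∑ i ∈ s, (⟪x, z i⟫ / ‖z i‖ ^ 2) • z i with hp
  have horth : ∀ j ∈ s, ⟪x - p, z j⟫ = 0 := fun j hj => by
    rw [inner_sub_left, hp, sum_inner, Finset.sum_eq_single j]
    · rw [real_inner_smul_left, real_inner_self_eq_norm_sq]
      -- Zero vectors are allowed: their coefficient is `0 / 0 = 0`.
      by_cases h0 : z j = 0
      · simp [h0]
      · rw [div_mul_cancel₀ _ (pow_ne_zero 2 (norm_ne_zero_iff.mpr h0)), sub_self]
    · intro i _ hij
      rw [real_inner_smul_left, hz i j hij, mul_zero]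
    · exact fun h => absurd hj h
  have h0 : ⟪x - p, p - ∑ i ∈ s, z i⟫ = 0 := by
    rw [hp, ← Finset.sum_sub_distrib, inner_sum, ← hp]
    refine Finset.sum_eq_zero fun i hi => ?_
    rw [inner_sub_right, real_inner_smul_right, horth i hi, mul_zero, sub_zero]
  have h1 := norm_add_sq_eq_norm_sq_add_norm_sq_of_inner_eq_zero _ _ h0
  rw [sub_add_sub_cancel] at h1
  refine le_of_sq_le_sq ?_ (norm_nonneg _)
  nlinarith [mul_self_nonneg ‖p - ∑ i ∈ s, z i‖]

/-- If combinations of eigenvectors of the symmetric operator `T` approximate `w`, and `w` is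
orthogonal to the eigenvectors with negative eigenvalue, then `⟨T w, w⟩ ≥ 0`. -/
theorem inner_nonneg_of_orthogonal
    (hsymm : ∀ u v : T.domain, ⟪J (T u), J v⟫ = ⟪J u, J (T v)⟫) (w : T.domain)
    (hdense : ∀ ε : ℝ, 0 < ε → ∃ f : ℝ →₀ V,
      (∀ lam, ∃ h : f lam ∈ T.domain, T ⟨f lam, h⟩ = lam • f lam) ∧
      ‖J w - J (f.sum fun _ x => x)‖ < ε)
    (horth : ∀ lam : ℝ, lam < 0 → ∀ z : T.domain, T z = lam • (z : V) → ⟪J w, J z⟫ = 0) :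
    0 ≤ ⟪J (T w), J w⟫ := by
  by_contra! hneg
  -- The tolerance makes the Cauchy–Schwarz error `‖J (T w)‖ * ε` smaller than `-⟪J (T w), J w⟫`;
  -- the `+ 1` keeps the denominator positive.
  obtain ⟨f, hf, hlt⟩ := hdense (-⟪J (T w), J w⟫ / (‖J (T w)‖ + 1)) (by
    have := norm_nonneg (J (T w))
    apply div_pos <;> linarith)
  choose hfd hfT using hf
  have hJ : J (f.sum fun _ x => x) = ∑ lam ∈ f.support, J (f lam) := by
    rw [Finsupp.sum, map_sum]
  rw [hJ] at hlt
  -- Replace the approximating sum by the orthogonal projection `p` of `J w` onto the same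
  -- eigenvectors. This is at least as close, and its pairing with `J (T w)` is a sum of terms `lam
  -- * ⟪J w, J (f lam)⟫ ^ 2 / ‖J (f lam)‖ ^ 2`, which vanish for negative `lam`.
  have hle := (norm_sub_sum_proj_le f.support (fun lam => J (f lam))
    (fun lam mu hne => inner_eigenvector_eq_zero hsymm hne (u := ⟨_, hfd lam⟩)
      (v := ⟨_, hfd mu⟩) (hfT lam) (hfT mu)) (J w)).trans_lt hlt
  set p := ∑ lam ∈ f.support, (⟪J w, J (f lam)⟫ / ‖J (f lam)‖ ^ 2) • J (f lam) with hp
  have hpos : 0 ≤ ⟪J (T w), p⟫ := by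
    rw [hp, inner_sum]
    refine Finset.sum_nonneg fun lam _ => ?_
    have h1 : ⟪J (T w), J (f lam)⟫ = lam * ⟪J w, J (f lam)⟫ := by
      have := hsymm w ⟨_, hfd lam⟩
      rwa [hfT, map_smul, real_inner_smul_right] at this
    rw [real_inner_smul_right, h1]
    rcases lt_or_ge lam 0 with hl | hl
    · rw [horth lam hl ⟨_, hfd lam⟩ (hfT lam)]
      simp
    · rw [div_mul_eq_mul_div]
      refine div_nonneg ?_ (sq_nonneg _)
      nlinarith [mul_nonneg hl (mul_self_nonneg ⟪J w, J (f lam)⟫)]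
  have hcs := abs_le.mp (abs_real_inner_le_norm (J (T w)) (J w - p))
  rw [inner_sub_right] at hcs
  rw [lt_div_iff₀ (by positivity)] at hle
  nlinarith [hcs.1, norm_nonneg (J w - p), norm_nonneg (J (T w))]

/-- A combination `w` of eigenvectors of `T` with negative eigenvalues vanishes when
`⟨T' (α w), α w⟩ ≥ 0`, where `T' α = β T`. -/
theorem eq_zero_of_inner_nonneg
    (hsymm : ∀ u v : T'.domain, ⟪J (T' u), J v⟫ = ⟪J u, J (T' v)⟫) (α β : V →ₗ[ℝ] V)
    (hα : ∀ u : T.domain, α u ∈ T'.domain)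
    (hT : ∀ u : T.domain, T' ⟨α u, hα u⟩ = β (T u))
    (hαβ : ∀ u v, ⟪J (β u), J (α v)⟫ = ⟪J (α u), J (β v)⟫)
    (hpos : ∀ u, u ≠ 0 → 0 < ⟪J (β u), J (α u)⟫)
    (f : {lam : ℝ // lam < 0} →₀ V) (hfd : ∀ lam, f lam ∈ T.domain)
    (hfT : ∀ lam, T ⟨f lam, hfd lam⟩ = (lam : ℝ) • f lam) (w : T.domain)
    (hw : (w : V) = f.sum fun _ x => x) (hnn : 0 ≤ ⟪J (T' ⟨α w, hα w⟩), J (α w)⟫) :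
    f = 0 := by
  -- By `hαβ` the form `⟪J (β u), J (α v)⟫` is symmetric, and symmetry of `T'` makes `T` symmetric
  -- for it. Hence eigenvectors of `T` with distinct eigenvalues are orthogonal for this form, with
  -- no symmetry of `T` in the original inner product.
  have hoff : ∀ lam mu, lam ≠ mu → ⟪J (β (f lam)), J (α (f mu))⟫ = 0 := fun lam mu hne => by
    have h := hsymm ⟨α (f lam), hα ⟨_, hfd lam⟩⟩ ⟨α (f mu), hα ⟨_, hfd mu⟩⟩
    rw [hT ⟨_, hfd lam⟩, hT ⟨_, hfd mu⟩, hfT, hfT] at h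
    simp only [map_smul, real_inner_smul_left, real_inner_smul_right] at h
    rw [← hαβ] at h
    have h' : ((lam : ℝ) - mu) * ⟪J (β (f lam)), J (α (f mu))⟫ = 0 := by
      rw [sub_mul, h, sub_self]
    exact (mul_eq_zero.mp h').resolve_left (sub_ne_zero.mpr fun h => hne (Subtype.ext h))
  have hwsum : w = ∑ lam ∈ f.support, (⟨f lam, hfd lam⟩ : T.domain) := by
    ext1
    rw [hw, Submodule.coe_sum, Finsupp.sum]
  have hTw : T w = ∑ lam ∈ f.support, (lam : ℝ) • f lam := by
    rw [hwsum]
    change T.toFun _ = _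
    rw [map_sum]
    exact Finset.sum_congr rfl fun lam _ => hfT lam
  have hsum : ⟪J (T' ⟨α w, hα w⟩), J (α w)⟫ =
      ∑ lam ∈ f.support, (lam : ℝ) * ⟪J (β (f lam)), J (α (f lam))⟫ := by
    rw [hT, hTw, hw, Finsupp.sum]
    simp only [map_sum, map_smul, sum_inner, real_inner_smul_left]
    refine Finset.sum_congr rfl fun lam hlam => ?_
    rw [inner_sum, Finset.sum_eq_single lam (fun mu _ hne => hoff lam mu hne.symm)
      fun h => absurd hlam h]
  rw [hsum] at hnn
  by_contra hf0
  have hlt : ∑ lam ∈ f.support, (lam : ℝ) * ⟪J (β (f lam)), J (α (f lam))⟫ < 0 :=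
    Finset.sum_neg (fun lam hlam =>
      mul_neg_of_neg_of_pos lam.2 (hpos _ (Finsupp.mem_support_iff.mp hlam)))
      (Finsupp.support_nonempty_iff.mpr hf0)
  exact hlt.not_ge hnn

end Spectral

end ConfNodal

namespace ConfNodal

/-! ### Covariance and comparison of negative eigenspaces -/

section Operators

open scoped RealInnerProductSpace

variable {n : ℕ} [NeZero n] {M : Type*} [TopologicalSpace M]
  [ChartedSpace (EuclideanHalfSpace n) M]

theorem expMul_mul_expMul_neg (c : ℝ) (φ : Smooth n M) : expMul c φ * expMul (-c) φ = 1 := by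
  ext x
  change Real.exp (c * φ x) * Real.exp (-c * φ x) = 1
  rw [← Real.exp_add, neg_mul, add_neg_cancel, Real.exp_zero]

theorem expMul_mul_expMul_neg_mul (c : ℝ) (φ u : Smooth n M) :
    expMul c φ * (expMul (-c) φ * u) = u := by
  rw [← mul_assoc, expMul_mul_expMul_neg, one_mul]

theorem expMul_neg_right (c : ℝ) (φ : Smooth n M) : expMul c (-φ) = expMul (-c) φ := by
  ext x
  change Real.exp (c * -φ x) = Real.exp (-c * φ x)
  rw [mul_neg, neg_mul]

section L2

variable [CompactSpace M] [MeasurableSpace M] [BorelSpace M]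

/-- Smooth functions as elements of `L²(μ)`. -/
noncomputable def toL2 (μ : Measure M) [IsFiniteMeasure μ] : Smooth n M →ₗ[ℝ] Lp ℝ 2 μ where
  toFun u := ContinuousMap.toLp 2 μ ℝ ⟨u, u.contMDiff.continuous⟩
  map_add' u v := map_add (ContinuousMap.toLp 2 μ ℝ) ⟨u, u.contMDiff.continuous⟩
    ⟨v, v.contMDiff.continuous⟩
  map_smul' c u := map_smul (ContinuousMap.toLp 2 μ ℝ) c ⟨u, u.contMDiff.continuous⟩

variable {μ : Measure M} [IsFiniteMeasure μ]

theorem inner_toL2 (u v : Smooth n M) : ⟪toL2 μ u, toL2 μ v⟫ = ∫ x, u x * v x ∂μ := by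
  refine (ContinuousMap.inner_toLp (𝕜 := ℝ) μ ⟨u, u.contMDiff.continuous⟩
    ⟨v, v.contMDiff.continuous⟩).trans (integral_congr_ae (.of_forall fun x => ?_))
  exact mul_comm (v x) (u x)

theorem norm_toL2 (u : Smooth n M) : ‖toL2 μ u‖ = (eLpNorm u 2 μ).toReal := by
  rw [Lp.norm_def]
  exact congrArg _ (eLpNorm_congr_ae
    (ContinuousMap.coeFn_toLp (𝕜 := ℝ) μ ⟨u, u.contMDiff.continuous⟩))

theorem memLp_smooth (u : Smooth n M) : MemLp u 2 μ :=
  MemLp.of_bound u.contMDiff.continuous.aestronglyMeasurable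
    ‖(⟨u, u.contMDiff.continuous⟩ : C(M, ℝ))‖
    (.of_forall fun x => ContinuousMap.norm_coe_le_norm ⟨u, u.contMDiff.continuous⟩ x)

theorem inner_toL2_expMul (a b : ℝ) (φ u v : Smooth n M) :
    ⟪toL2 μ (expMul b φ * u), toL2 μ (expMul a φ * v)⟫ =
      ⟪toL2 μ (expMul a φ * u), toL2 μ (expMul b φ * v)⟫ := by
  rw [inner_toL2, inner_toL2]
  refine integral_congr_ae (.of_forall fun x => ?_)
  change expMul b φ x * u x * (expMul a φ x * v x) = expMul a φ x * u x * (expMul b φ x * v x)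
  ring

/-- The integrand is `u ^ 2` times a positive function; it is continuous and positive on a nonempty
open set, which `μ` charges. -/
theorem inner_toL2_expMul_pos [μ.IsOpenPosMeasure] (a b : ℝ) (φ : Smooth n M) {u : Smooth n M}
    (hu : u ≠ 0) : 0 < ⟪toL2 μ (expMul b φ * u), toL2 μ (expMul a φ * u)⟫ := by
  obtain ⟨x, hx⟩ : ∃ x, u x ≠ 0 := by
    by_contra! h
    exact hu (ContMDiffMap.ext h)
  have hfac : ∀ x, (expMul b φ * u) x * (expMul a φ * u) x =
      expMul b φ x * expMul a φ x * u x ^ 2 := fun x => by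
    change expMul b φ x * u x * (expMul a φ x * u x) = _
    ring
  have hp : ∀ x, 0 < expMul b φ x * expMul a φ x := fun x =>
    mul_pos (Real.exp_pos _) (Real.exp_pos _)
  rw [inner_toL2]
  refine Continuous.integral_pos_of_hasCompactSupport_nonneg_nonzero (x := x)
    ((expMul b φ * u).contMDiff.continuous.mul (expMul a φ * u).contMDiff.continuous)
    (HasCompactSupport.of_compactSpace _) (fun y => ?_) ?_
  · simp only [hfac]
    exact mul_nonneg (hp y).le (sq_nonneg _)
  · rw [hfac]
    exact mul_ne_zero (hp x).ne' (pow_ne_zero 2 hx)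

end L2

theorem mem_eigenspace_iff {T : Smooth n M →ₗ.[ℝ] Smooth n M} {lam : ℝ} {u : Smooth n M} :
    u ∈ eigenspace T lam ↔ ∃ h : u ∈ T.domain, T ⟨u, h⟩ = lam • u := by
  simp only [eigenspace, Submodule.mem_map, LinearMap.mem_ker, LinearMap.sub_apply,
    LinearMap.smul_apply, Submodule.subtype_apply, sub_eq_zero]
  constructor
  · rintro ⟨v, hv, rfl⟩
    exact ⟨v.2, hv⟩
  · rintro ⟨h, hu⟩
    exact ⟨⟨u, h⟩, hu, rfl⟩

variable [IsManifold (𝓡∂ n) ∞ M]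

theorem IsConformalChange.symm {g g' : Metric n M} {φ : Smooth n M}
    (h : IsConformalChange g g' φ) : IsConformalChange g' g (-φ) := fun x v w => by
  rw [h, ← mul_assoc, ← Real.exp_add]
  change _ = Real.exp (2 * -φ x + 2 * φ x) * _
  rw [mul_neg, neg_add_cancel, Real.exp_zero, one_mul]

variable [T2Space M] [CompactSpace M] [MeasurableSpace M] [BorelSpace M]

/-- Only the spectral hypothesis at `g'` enters: the abstract lemmas apply with `T = P g`, `T' = P
g'`, `α` multiplication by `e^{-aφ}` and `β` multiplication by `e^{-bφ}`. -/
theorem numNegEigenvalues_le {P : OperatorFamily n M} {C : Set (Metric n M)} {a b : ℝ}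
    (hcov : IsConformallyCovariant P C a b) {g g' : Metric n M} (hg : g ∈ C) (hg' : g' ∈ C)
    {φ : Smooth n M} (hφ : IsConformalChange g g' φ) (hc : HasCompleteEigenfunctions P g') :
    numNegEigenvalues (P g) ≤ numNegEigenvalues (P g') := by
  obtain ⟨hdom, hop⟩ := hcov g hg g' hg' φ hφ
  have hα : ∀ u : (P g).domain,
      LinearMap.mulLeft ℝ (expMul (-a) φ) (u : Smooth n M) ∈ (P g').domain := fun u => by
    rw [hdom, LinearMap.mulLeft_apply, expMul_mul_expMul_neg_mul]
    exact u.2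
  have hT : ∀ u : (P g).domain, P g' ⟨_, hα u⟩ = LinearMap.mulLeft ℝ (expMul (-b) φ) (P g u) :=
    fun u => hop _ _ (expMul_mul_expMul_neg_mul a φ u).symm
  set J := toL2 (n := n) (volM g') with hJ
  have hsymm : ∀ u v : (P g').domain, ⟪J (P g' u), J v⟫ = ⟪J u, J (P g' v)⟫ := fun u v => by
    rw [hJ, inner_toL2, inner_toL2]
    exact hc.1 u v
  have hdense : ∀ (w : Smooth n M) (ε : ℝ), 0 < ε → ∃ f : ℝ →₀ Smooth n M,
      (∀ lam, ∃ h : f lam ∈ (P g').domain, P g' ⟨f lam, h⟩ = lam • f lam) ∧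
      ‖J w - J (f.sum fun _ x => x)‖ < ε := fun w ε hε => by
    obtain ⟨v, hv, hlt⟩ := hc.2 w (memLp_smooth w) (ENNReal.ofReal ε) (ENNReal.ofReal_pos.mpr hε)
    obtain ⟨f, hf, rfl⟩ := (Submodule.mem_iSup_iff_exists_finsupp _ _).mp hv
    refine ⟨f, fun lam => mem_eigenspace_iff.mp (hf lam), ?_⟩
    rw [← map_sub, hJ, norm_toL2]
    exact ENNReal.toReal_lt_of_lt_ofReal hlt
  -- The pairing `(w, z) ↦ ⟪J (e^{-aφ} w), J z⟫` between the two negative spaces; an element of its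
  -- kernel satisfies the orthogonality hypothesis of `inner_nonneg_of_orthogonal`.
  let Ψ : ↥(⨆ lam : {lam : ℝ // lam < 0}, eigenspace (P g) lam) →ₗ[ℝ]
      Module.Dual ℝ ↥(⨆ lam : {lam : ℝ // lam < 0}, eigenspace (P g') lam) :=
    ((innerₗ (Lp ℝ 2 (volM g'))).compl₁₂ (J ∘ₗ LinearMap.mulLeft ℝ (expMul (-a) φ)) J).domRestrict₁₂
      _ _
  refine toENat_rank_le_of_injective_dual Ψ ?_
  rw [← LinearMap.ker_eq_bot, LinearMap.ker_eq_bot']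
  rintro ⟨w, hw⟩ hΨ
  obtain ⟨f, hf, hfw⟩ := (Submodule.mem_iSup_iff_exists_finsupp _ _).mp hw
  simp only [mem_eigenspace_iff] at hf
  choose hfd hfT using hf
  have hwd : w ∈ (P g).domain := by
    rw [← hfw]
    exact Submodule.sum_mem _ fun lam _ => hfd lam
  have horth : ∀ lam : ℝ, lam < 0 → ∀ z : (P g').domain, P g' z = lam • (z : Smooth n M) →
      ⟪J (LinearMap.mulLeft ℝ (expMul (-a) φ) w), J z⟫ = 0 := fun lam hlam z hz => by
    have hmem : (z : Smooth n M) ∈ ⨆ lam : {lam : ℝ // lam < 0}, eigenspace (P g') lam :=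
      Submodule.mem_iSup_of_mem ⟨lam, hlam⟩ (mem_eigenspace_iff.mpr ⟨z.2, hz⟩)
    exact LinearMap.congr_fun hΨ ⟨z, hmem⟩
  have hf0 := eq_zero_of_inner_nonneg hsymm (LinearMap.mulLeft ℝ (expMul (-a) φ))
    (LinearMap.mulLeft ℝ (expMul (-b) φ)) hα hT
    (fun u v => inner_toL2_expMul (-a) (-b) φ u v)
    (fun u hu => inner_toL2_expMul_pos (-a) (-b) φ hu) f hfd hfT ⟨w, hwd⟩ hfw.symm
    (inner_nonneg_of_orthogonal hsymm ⟨_, hα ⟨w, hwd⟩⟩ (hdense _) horth)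
  subst hf0
  exact Subtype.ext hfw.symm

theorem numNegEigenvalues_eq {P : OperatorFamily n M} {C : Set (Metric n M)} {a b : ℝ}
    (hcov : IsConformallyCovariant P C a b) {g g' : Metric n M} (hg : g ∈ C) (hg' : g' ∈ C)
    {φ : Smooth n M} (hφ : IsConformalChange g g' φ) (hc : HasCompleteEigenfunctions P g)
    (hc' : HasCompleteEigenfunctions P g') :
    numNegEigenvalues (P g') = numNegEigenvalues (P g) :=
  (numNegEigenvalues_le hcov hg' hg hφ.symm hc).antisymm
    (numNegEigenvalues_le hcov hg hg' hφ hc')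

end Operators

/-! ### Transformation of the kernel and of its restrictions -/

section Kernel

variable {n : ℕ} [NeZero n] {M : Type*} [TopologicalSpace M]
  [ChartedSpace (EuclideanHalfSpace n) M] [IsManifold (𝓡∂ n) ∞ M]
  {P : OperatorFamily n M} {C : Set (Metric n M)} {g g' : Metric n M} {φ : Smooth n M}

theorem expMul_mul_mem_kernel (hker : KernelTransforms P C) (hg : g ∈ C) (hg' : g' ∈ C)
    (hφ : IsConformalChange g g' φ) {u : Smooth n M} (hu : u ∈ kernel (P g)) :
    expMul (-((n : ℝ) / 2 - 1)) φ * u ∈ kernel (P g') := by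
  rw [← SetLike.mem_coe, hker g hg g' hg' φ hφ]
  exact ⟨u, hu, rfl⟩

theorem expMul_mul_mem_kernel_symm (hker : KernelTransforms P C) (hg : g ∈ C) (hg' : g' ∈ C)
    (hφ : IsConformalChange g g' φ) {u : Smooth n M} (hu : u ∈ kernel (P g')) :
    expMul ((n : ℝ) / 2 - 1) φ * u ∈ kernel (P g) := by
  have h := expMul_mul_mem_kernel hker hg' hg hφ.symm hu
  rwa [expMul_neg_right, neg_neg] at h

/-- The factor on `X` is the pullback of the one on `M`, so a general `j` costs nothing. The inverse
direction is the conformal change by `-φ`. -/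
theorem isMulTransform_kernelOn (hker : KernelTransforms P C) (hg : g ∈ C) (hg' : g' ∈ C)
    (hφ : IsConformalChange g g' φ) {X : Type*} (j : X → M) :
    IsMulTransform (fun x => expMul (-((n : ℝ) / 2 - 1)) φ (j x)) (kernelOn P g j)
      (kernelOn P g' j) where
  ne_zero x := (Real.exp_pos _).ne'
  mul_mem := by
    rintro _ ⟨u, hu, rfl⟩
    exact ⟨_, expMul_mul_mem_kernel hker hg hg' hφ hu, rfl⟩
  inv_mul_mem := by
    rintro _ ⟨u, hu, rfl⟩
    refine ⟨_, expMul_mul_mem_kernel_symm hker hg hg' hφ hu, ?_⟩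
    ext x
    change Real.exp (((n : ℝ) / 2 - 1) * φ (j x)) * u (j x) =
      (Real.exp (-((n : ℝ) / 2 - 1) * φ (j x)))⁻¹ * u (j x)
    rw [neg_mul, Real.exp_neg, inv_inv]

theorem rank_kernel_eq (hker : KernelTransforms P C) (hg : g ∈ C) (hg' : g' ∈ C)
    (hφ : IsConformalChange g g' φ) :
    Module.rank ℝ (kernel (P g')) = Module.rank ℝ (kernel (P g)) := by
  have hinj : Function.Injective (pullback (n := n) (id : M → M)) := fun u v h =>
    ContMDiffMap.ext fun x => congrFun h x
  have e := fun g : Metric n M =>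
    (Submodule.equivMapOfInjective (pullback (n := n) (id : M → M)) hinj (kernel (P g))).rank_eq
  rw [e, e]
  exact (isMulTransform_kernelOn hker hg hg' hφ id).rank_eq

end Kernel

/-! ### Invariance of the density `|u|^p dvol` -/

section Density

variable {N : Type*} [MeasurableSpace N] {μ μ' : Measure N}

/-- `|e^{-sψ} u|^{d/s} (e^{dψ} μ) = |u|^{d/s} μ`. -/
theorem withDensity_abs_rpow_conformal {d : ℕ} {ψ u u' : N → ℝ} {s p : ℝ} (hs : s * p = d)
    (hψ : Measurable ψ) (hu : Measurable u')
    (hμ : μ' = μ.withDensity fun x => ENNReal.ofReal (Real.exp (d * ψ x)))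
    (huu : ∀ x, u' x = Real.exp (-s * ψ x) * u x) :
    μ'.withDensity (fun x => ENNReal.ofReal (|u' x| ^ p)) =
      μ.withDensity (fun x => ENNReal.ofReal (|u x| ^ p)) := by
  have h1 : Measurable fun x => ENNReal.ofReal (Real.exp (d * ψ x)) := by fun_prop
  have h2 : Measurable fun x => ENNReal.ofReal (|u' x| ^ p) :=
    (hu.abs.pow_const p).ennreal_ofReal
  rw [hμ, ← withDensity_mul _ h1 h2]
  congr 1
  ext x
  rw [Pi.mul_apply, ← ENNReal.ofReal_mul (Real.exp_pos _).le, huu, abs_mul,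
    abs_of_pos (Real.exp_pos _), Real.mul_rpow (Real.exp_pos _).le (abs_nonneg _), ← Real.exp_mul,
    ← mul_assoc, ← Real.exp_add]
  have : d * ψ x + -s * ψ x * p = 0 := by
    rw [← hs]
    ring
  rw [this, Real.exp_zero, one_mul]

theorem lintegral_abs_rpow_eq {u u' : N → ℝ} {p : ℝ}
    (h : μ'.withDensity (fun x => ENNReal.ofReal (|u' x| ^ p)) =
      μ.withDensity (fun x => ENNReal.ofReal (|u x| ^ p))) {Ω : Set N} (hΩ : MeasurableSet Ω) :
    ∫⁻ x in Ω, ENNReal.ofReal (|u' x| ^ p) ∂μ' = ∫⁻ x in Ω, ENNReal.ofReal (|u x| ^ p) ∂μ := by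
  rw [← withDensity_apply _ hΩ, ← withDensity_apply _ hΩ, h]

theorem eLpNorm_eq_lintegral_abs_rpow {u : N → ℝ} {p : ℝ} (hp : 0 < p) :
    eLpNorm u (ENNReal.ofReal p) μ = (∫⁻ x, ENNReal.ofReal (|u x| ^ p) ∂μ) ^ (1 / p) := by
  rw [eLpNorm_eq_lintegral_rpow_enorm_toReal (by simpa using hp) ENNReal.ofReal_ne_top,
    ENNReal.toReal_ofReal hp.le]
  congr 1
  refine lintegral_congr fun x => ?_
  rw [← ENNReal.ofReal_rpow_of_nonneg (abs_nonneg _) hp.le, ← Real.norm_eq_abs, ofReal_norm]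

theorem eLpNorm_eq_of_withDensity_eq {u u' : N → ℝ} {p : ℝ} (hp : 0 ≤ p)
    (h : μ'.withDensity (fun x => ENNReal.ofReal (|u' x| ^ p)) =
      μ.withDensity (fun x => ENNReal.ofReal (|u x| ^ p))) :
    eLpNorm u' (ENNReal.ofReal p) μ' = eLpNorm u (ENNReal.ofReal p) μ := by
  -- The exponent `p = 0` occurs for zero-dimensional submanifolds; there both seminorms are `0` by
  -- convention.
  rcases hp.eq_or_lt with rfl | hp
  · simp
  · have h' := lintegral_abs_rpow_eq h MeasurableSet.univ
    rw [setLIntegral_univ, setLIntegral_univ] at h'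
    rw [eLpNorm_eq_lintegral_abs_rpow hp, eLpNorm_eq_lintegral_abs_rpow hp, h']

theorem conformal_density_identities {d : ℕ} {ψ u u' : N → ℝ} {s p : ℝ} (hs : s * p = d)
    (hp : 0 ≤ p) (hψ : Measurable ψ) (hu : Measurable u')
    (hμ : μ' = μ.withDensity fun x => ENNReal.ofReal (Real.exp (d * ψ x)))
    (huu : ∀ x, u' x = Real.exp (-s * ψ x) * u x) :
    μ'.withDensity (fun x => ENNReal.ofReal (|u' x| ^ p)) =
        μ.withDensity (fun x => ENNReal.ofReal (|u x| ^ p)) ∧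
      eLpNorm u' (ENNReal.ofReal p) μ' = eLpNorm u (ENNReal.ofReal p) μ ∧
      ∀ Ω : Set N, MeasurableSet Ω →
        ∫⁻ x in Ω, ENNReal.ofReal (|u' x| ^ p) ∂μ' = ∫⁻ x in Ω, ENNReal.ofReal (|u x| ^ p) ∂μ := by
  have h := withDensity_abs_rpow_conformal hs hψ hu hμ huu
  exact ⟨h, eLpNorm_eq_of_withDensity_eq hp h, fun Ω hΩ => lintegral_abs_rpow_eq h hΩ⟩

end Density

end ConfNodal

theorem proposition2p2 (n : ℕ) [NeZero n] (hn : 3 ≤ n)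
    (M : Type*) [TopologicalSpace M] [T2Space M] [CompactSpace M]
    [ChartedSpace (EuclideanHalfSpace n) M] [IsManifold (𝓡∂ n) ∞ M]
    [MeasurableSpace M] [BorelSpace M]
    (P : OperatorFamily n M) (C : Set (Metric n M)) (a b : ℝ)
    (hcov : IsConformallyCovariant P C a b)
    (hker : KernelTransforms P C)
    (g : Metric n M) (hg : g ∈ C) (hk : 1 ≤ Module.rank ℝ (kernel (P g)))
    (g' : Metric n M) (hg' : g' ∈ C) (φ : Smooth n M) (hφ : IsConformalChange g g' φ) :
    -- the dimension of the kernel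
    Module.rank ℝ (kernel (P g')) = Module.rank ℝ (kernel (P g)) ∧
    -- the number of negative eigenvalues
    (HasCompleteEigenfunctions P g → HasCompleteEigenfunctions P g' →
      numNegEigenvalues (P g') = numNegEigenvalues (P g)) ∧
    -- nodal sets and nodal domains
    (∀ u ∈ kernel (P g), u ≠ 0 → ∀ u', u' = expMul (-((n : ℝ) / 2 - 1)) φ * u →
      u' ∈ kernel (P g') ∧ u' ≠ 0 ∧ nodalSet u' = nodalSet u ∧
      nodalDomains u' = nodalDomains u) ∧
    allNodalSets (kernelOn P g' (id : M → M)) = allNodalSets (kernelOn P g (id : M → M)) ∧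
    allNodalDomains (kernelOn P g' (id : M → M)) = allNodalDomains (kernelOn P g (id : M → M)) ∧
    -- intersections of nodal sets and complements
    (2 ≤ Module.rank ℝ (kernel (P g)) →
      nodalIntersections (kernelOn P g' (id : M → M)) =
        nodalIntersections (kernelOn P g (id : M → M)) ∧
      nodalIntersectionComplements (kernelOn P g' (id : M → M)) =
        nodalIntersectionComplements (kernelOn P g (id : M → M))) ∧
    -- the orbit of the projective map, and its values on `∂M`, for any bases of the kernels
    (∀ k : ℕ, 2 ≤ k → ∀ (u : Module.Basis (Fin k) ℝ (kernelOn P g (id : M → M)))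
        (u' : Module.Basis (Fin k) ℝ (kernelOn P g' (id : M → M))),
      commonNodalSet (fun i => (u' i : M → ℝ)) = commonNodalSet (fun i => (u i : M → ℝ)) ∧
      (∃ A : GL (Fin k) ℝ, ∀ x h h',
        projMap (fun i => (u' i : M → ℝ)) ⟨x, h'⟩ =
          A • projMap (fun i => (u i : M → ℝ)) ⟨x, h⟩) ∧
      projOrbit (fun i => (u' i : M → ℝ)) = projOrbit (fun i => (u i : M → ℝ)) ∧
      projOrbit (fun i (x : (𝓡∂ n).boundary M) => (u' i : M → ℝ) x) =
        projOrbit (fun i (x : (𝓡∂ n).boundary M) => (u i : M → ℝ) x)) ∧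
    -- the same for `∂M` and the restrictions of the kernel to `∂M`
    (∀ j : (𝓡∂ n).boundary M → M, j = Subtype.val →
      Module.rank ℝ (kernelOn P g' j) = Module.rank ℝ (kernelOn P g j) ∧
      (∀ u ∈ kernel (P g), ∀ u', u' = expMul (-((n : ℝ) / 2 - 1)) φ * u →
        nodalSet (u' ∘ j) = nodalSet (u ∘ j) ∧ nodalDomains (u' ∘ j) = nodalDomains (u ∘ j)) ∧
      allNodalSets (kernelOn P g' j) = allNodalSets (kernelOn P g j) ∧
      allNodalDomains (kernelOn P g' j) = allNodalDomains (kernelOn P g j) ∧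
      nodalIntersections (kernelOn P g' j) = nodalIntersections (kernelOn P g j) ∧
      nodalIntersectionComplements (kernelOn P g' j) =
        nodalIntersectionComplements (kernelOn P g j) ∧
      ∀ k : ℕ, ∀ (u : Module.Basis (Fin k) ℝ (kernelOn P g j))
          (u' : Module.Basis (Fin k) ℝ (kernelOn P g' j)),
        commonNodalSet (fun i => (u' i : (𝓡∂ n).boundary M → ℝ)) =
          commonNodalSet (fun i => (u i : (𝓡∂ n).boundary M → ℝ)) ∧
        projOrbit (fun i => (u' i : (𝓡∂ n).boundary M → ℝ)) =
          projOrbit (fun i => (u i : (𝓡∂ n).boundary M → ℝ))) ∧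
    -- the density `|u|^p dvol` on `M`, and on immersed submanifolds (`∂M` among them)
    (∀ u ∈ kernel (P g), ∀ u', u' = expMul (-((n : ℝ) / 2 - 1)) φ * u →
      (∀ p : ℝ, p = 2 * n / (n - 2) →
        (volM g').withDensity (fun x => ENNReal.ofReal (|u' x| ^ p)) =
          (volM g).withDensity (fun x => ENNReal.ofReal (|u x| ^ p)) ∧
        eLpNorm u' (ENNReal.ofReal p) (volM g') = eLpNorm u (ENNReal.ofReal p) (volM g) ∧
        ∀ Ω : Set M, MeasurableSet Ω →
          ∫⁻ x in Ω, ENNReal.ofReal (|u' x| ^ p) ∂(volM g') =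
            ∫⁻ x in Ω, ENNReal.ofReal (|u x| ^ p) ∂(volM g)) ∧
      ∀ (d : ℕ) (H N : Type*) [TopologicalSpace H]
        (J : ModelWithCorners ℝ (EuclideanSpace ℝ (Fin d)) H) [TopologicalSpace N]
        [ChartedSpace H N] [IsManifold J ∞ N] [T2Space N] [SigmaCompactSpace N]
        [MeasurableSpace N] [BorelSpace N] (ι : N → M),
        ContMDiff J (𝓡∂ n) ∞ ι → (∀ x, Function.Injective (mfderiv J (𝓡∂ n) ι x)) →
        ∀ p : ℝ, p = 2 * d / (n - 2) →
          (volSub g' J ι).withDensity (fun x => ENNReal.ofReal (|u' (ι x)| ^ p)) =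
            (volSub g J ι).withDensity (fun x => ENNReal.ofReal (|u (ι x)| ^ p)) ∧
          eLpNorm (fun x => u' (ι x)) (ENNReal.ofReal p) (volSub g' J ι) =
            eLpNorm (fun x => u (ι x)) (ENNReal.ofReal p) (volSub g J ι) ∧
          ∀ Ω : Set N, MeasurableSet Ω →
            ∫⁻ x in Ω, ENNReal.ofReal (|u' (ι x)| ^ p) ∂(volSub g' J ι) =
              ∫⁻ x in Ω, ENNReal.ofReal (|u (ι x)| ^ p) ∂(volSub g J ι)) := by
  have hn2 : (0 : ℝ) < n - 2 := by
    have : (3 : ℝ) ≤ n := by exact_mod_cast hn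
    linarith
  have hT := fun {X : Type _} (j : X → M) => isMulTransform_kernelOn hker hg hg' hφ j
  refine ⟨rank_kernel_eq hker hg hg' hφ, numNegEigenvalues_eq hcov hg hg' hφ, ?_,
    (hT id).allNodalSets_eq, (hT id).allNodalDomains_eq,
    fun _ => ⟨(hT id).nodalIntersections_eq, (hT id).nodalIntersectionComplements_eq⟩, ?_, ?_, ?_⟩
  · rintro u hu hu0 _ rfl
    refine ⟨expMul_mul_mem_kernel hker hg hg' hφ hu, fun h => hu0 ?_,
      nodalSet_mul (hT id).ne_zero u, nodalDomains_mul (hT id).ne_zero u⟩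
    rw [← expMul_mul_expMul_neg_mul ((n : ℝ) / 2 - 1) φ u, h, mul_zero]
  · intro k _ u u'
    obtain ⟨A, hA⟩ := (hT id).exists_matrix u u'
    -- The relation `hA` is pointwise on `M`, so the same matrix serves on `∂M`, even where
    -- restricting the basis destroys linear independence.
    exact ⟨commonNodalSet_eq (hT id).ne_zero hA, ⟨A, fun x h h' => projMap_eq_smul hA x h h'⟩,
      projOrbit_eq (hT id).ne_zero hA, projOrbit_eq (hT Subtype.val).ne_zero fun x => hA x⟩
  · rintro j -
    refine ⟨(hT j).rank_eq, ?_, (hT j).allNodalSets_eq, (hT j).allNodalDomains_eq,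
      (hT j).nodalIntersections_eq, (hT j).nodalIntersectionComplements_eq, fun k u u' => ?_⟩
    · rintro u - _ rfl
      exact ⟨nodalSet_mul (hT j).ne_zero (u ∘ j), nodalDomains_mul (hT j).ne_zero (u ∘ j)⟩
    · obtain ⟨A, hA⟩ := (hT j).exists_matrix u u'
      exact ⟨commonNodalSet_eq (hT j).ne_zero hA, projOrbit_eq (hT j).ne_zero hA⟩
  · rintro u - _ rfl
    have hexp : ∀ (d : ℕ) (p : ℝ), p = 2 * d / (n - 2) →
        ((n : ℝ) / 2 - 1) * p = d ∧ 0 ≤ p := by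
      rintro d _ rfl
      refine ⟨?_, by positivity⟩
      field_simp
    refine ⟨fun p hp => ?_, ?_⟩
    · refine conformal_density_identities (hexp n p hp).1 (hexp n p hp).2
        φ.contMDiff.continuous.measurable (ContMDiffMap.contMDiff _).continuous.measurable ?_
        fun x => rfl
      -- `M` itself is the case of the identity immersion.
      rw [volM_eq_volSub, volM_eq_volSub]
      exact volSub_conformal hφ contMDiff_id
    · intro d H N _ J _ _ _ _ _ _ _ ι hι _ p hp
      exact conformal_density_identities (hexp d p hp).1 (hexp d p hp).2
        (φ.contMDiff.continuous.comp hι.continuous).measurable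
        ((ContMDiffMap.contMDiff _).continuous.comp hι.continuous).measurable
        (volSub_conformal hφ hι) fun x => rfl
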